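/- Let $E$ be a real normed vector space (for instance $\mathbb R^n$ with any norm), let $m_f,m_g\ge 1$ be integers, and let $f:[0,m_f]\to E$, $g:[0,m_g]\to E$ be polygonal curves, i.e. continuous maps with $f(i+\lambda)=(1-\lambda)f(i)+\lambda f(i+1)$ for integers $0\le i<m_f$ and $\lambda\in[0,1]$, and likewise for $g$. For $\delta\ge 0$ let $$F=\{(x,y)\in[0,m_f]\times[0,m_g] : \|f(x)-g(y)\|\le\delta\}$$ be the $\delta$-free space. Cell $(i,j)$ is $[i,i+1]\times[j,j+1]$ for $0\le i<m_f$, $0\le j<m_g$. The free part of each edge of a cell is a closed segment or empty; $a\le b$ denote the varying coordinates of its end points. *Parameters.* Use coordinates $\langle d,\cdot\rangle$ (identified with $d$) and $\langle d,+\rangle$ for $d\in\mathbb R$, ordered lexicographically with $\cdot<+$; $\langle d,+\rangle$ stands for "arbitrarily little more than $d$". A reachable subline of an edge is either empty ($\bot$) or a pair $[\tilde a,\tilde b]$ of such coordinates with $\tilde a\le\tilde b$; it consists of the points of the edge whose varying coordinate $t$ satisfies $\tilde a\le\langle t,\cdot\rangle\le\tilde b$. Whenever a rule below yields $\tilde a>\tilde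 b$, the subline is $\bot$. *Dynamic program.* Each cell $(i,j)$ gets a corner set $C_{i,j}\subseteq\{(i,j)\}$ and reachable sublines of its left, bottom, right and top edges. 1. $C_{0,0}=\{(0,0)\}$ and the left and bottom sublines of cell $(0,0)$ are $[0,0]$ if $(0,0)\in F$; otherwise these are empty. For $i,j>0$: $C_{i,0}=C_{0,j}=\emptyset$, the bottom subline of cell $(i,0)$ and the left subline of cell $(0,j)$ are $\bot$, and $C_{i,j}=\{(i,j)\}$ iff the top subline of cell $(i-1,j-1)$ is nonempty with $\tilde b=\langle i,\cdot\rangle$ or its right subline is nonempty with $\tilde b=\langle j,\cdot\rangle$. 2. For $i>0$ the left subline of cell $(i,j)$ is the right subline of cell $(i-1,j)$; for $j>0$ its bottom subline is the top subline of cell $(i,j-1)$. 3. Right subline of cell $(i,j)$. Let $[a,b]$ be the free part of the right edge; if it is empty the subline is $\bot$. Otherwise let $S$ be the following: if the left subline is $\bot$, then $S=\bot$; if it is $[\tilde l,\tilde h]$, then $S=\bot$ when $\tilde l\ge b$, $S=[\tilde l+\langle 0,+\rangle,\,b]$ when $a\le\tilde l<b$, and $S=[a,b]$ when $\tilde l<a$,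 where $\langle d,\cdot\rangle+\langle 0,+\rangle=\langle d,+\rangle+\langle 0,+\rangle=\langle d,+\rangle$. - If $C_{i,j}\ne\emptyset$, the right subline is $[\max(a,\langle j,+\rangle),\,b]$. - If $C_{i,j}=\emptyset$ and the bottom subline is nonempty with lower parameter $<\langle i+1,\cdot\rangle$, the right subline is $[a,b]$. - If $C_{i,j}=\emptyset$ and the bottom subline is nonempty with lower parameter $\not<\langle i+1,\cdot\rangle$, the right subline is $S$ if $S\neq\bot$, and $[j,j]$ (the single point $(i+1,j)$) if $S=\bot$. - If $C_{i,j}=\emptyset$ and the bottom subline is $\bot$, the right subline is $S$. 4. The top subline of cell $(i,j)$ is obtained by the same rule with the roles of the two coordinates (left/bottom, right/top, $i$/$j$) exchanged. The computed reachable portion of the top edge of cell $(i,j)$ is its top subline, together with the left end point $(i,j+1)$ of the edge if $C_{i,j+1}\neq\emptyset$ (where $C_{i,m_g}$ is given by the rule in 1). **Lemma.** The following are equivalent: (a) there is a continuous curve $\alpha:[0,1]\to F$ with $\alpha(0)=(0,0)$ and $\alpha(1)=(m_f,m_g)$, both of whose coordinates are strictly increasing; (b) $(m_f,m_g)$ belongs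 to the computed reachable portion of the top edge of cell $(m_f-1,m_g-1)$; (c) the top subline of cell $(m_f-1,m_g-1)$ is nonempty and its right end parameter, as a point, is $(m_f,m_g)$, i.e. $\tilde b=\langle m_f,\cdot\rangle$. -/

import Mathlib

namespace FrechetDecision

/-- A polygonal curve `f : [0, m] → E`: a continuous map on a nondegenerate interval which is
given by linear interpolation on every `[i, i + 1]` with `i < m`. -/
structure IsPolygonalCurve {E : Type*} [NormedAddCommGroup E] [NormedSpace ℝ E]
    (m : ℕ) (f : ℝ → E) : Prop where
  pos : 0 < m
  continuousOn : ContinuousOn f (Set.Icc 0 (m : ℝ))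
  interp : ∀ i : ℕ, i < m → ∀ t ∈ Set.Icc (0 : ℝ) 1,
    f ((i : ℝ) + t) = (1 - t) • f (i : ℝ) + t • f ((i : ℝ) + 1)

/-- The `δ`-free space of `f : [0, mf] → E` and `g : [0, mg] → E`. -/
def freeSpace {E : Type*} [NormedAddCommGroup E]
    (mf mg : ℕ) (f g : ℝ → E) (δ : ℝ) : Set (ℝ × ℝ) :=
  {p | p.1 ∈ Set.Icc 0 (mf : ℝ) ∧ p.2 ∈ Set.Icc 0 (mg : ℝ) ∧ ‖f p.1 - g p.2‖ ≤ δ}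

/-- `α` is a curve in `F` from `p` to `q`, parametrized by `[0, 1]`, continuous and strictly
increasing in both coordinates. -/
structure IsStrictMonoCurve (F : Set (ℝ × ℝ)) (p q : ℝ × ℝ) (α : unitInterval → ℝ × ℝ) :
    Prop where
  continuous : Continuous α
  strictMono_fst : StrictMono fun t => (α t).1
  strictMono_snd : StrictMono fun t => (α t).2
  mem : ∀ t, α t ∈ F
  source : α 0 = p
  target : α 1 = q

/-- Coordinates `⟨d, ·⟩` (`false`) and `⟨d, +⟩` (`true`), in lexicographic order; `⟨d, +⟩`
stands for a value that exceeds `d` by an arbitrarily small amount. -/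
abbrev EpsReal : Type := ℝ ×ₗ Bool

/-- The coordinate `⟨d, ·⟩`. -/
def exact (d : ℝ) : EpsReal := toLex (d, false)

/-- The coordinate `⟨d, +⟩`. -/
def plus (d : ℝ) : EpsReal := toLex (d, true)

/-- Addition of `⟨0, +⟩`: both `⟨d, ·⟩` and `⟨d, +⟩` become `⟨d, +⟩`. -/
def addEps (c : EpsReal) : EpsReal := plus (ofLex c).1

/-- The pair of computed end parameters of the reachable subline of a cell edge. Only the
coordinate that varies along the edge is recorded. The value `⊥` of the two parameters (empty
subline) is `none : Option Subline`. -/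
structure Subline where
  lo : EpsReal
  hi : EpsReal

open Classical in
/-- The subline from `lo` to `hi`; both parameters are set to `⊥` if `lo > hi`. -/
noncomputable def mkSubline (lo hi : EpsReal) : Option Subline :=
  if lo ≤ hi then some ⟨lo, hi⟩ else none

open Classical in
/-- The least and the greatest element of `S` (`none` if `S` is empty); used for sets `S` that
are compact. -/
noncomputable def endpoints (S : Set ℝ) : Option (ℝ × ℝ) :=
  if S.Nonempty then some (sInf S, sSup S) else none

/-- End points of the free part of the vertical edge `{i} × [j, j + 1]`. -/
noncomputable def freeVert (F : Set (ℝ × ℝ)) (i j : ℕ) : Option (ℝ × ℝ) :=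
  endpoints {y | y ∈ Set.Icc (j : ℝ) ((j : ℝ) + 1) ∧ ((i : ℝ), y) ∈ F}

/-- End points of the free part of the horizontal edge `[i, i + 1] × {j}`. -/
noncomputable def freeHor (F : Set (ℝ × ℝ)) (i j : ℕ) : Option (ℝ × ℝ) :=
  endpoints {x | x ∈ Set.Icc (i : ℝ) ((i : ℝ) + 1) ∧ (x, (j : ℝ)) ∈ F}

open Classical in
/-- Reachable subline of an exit edge with free part `[a, b]` when the cell is entered through
the opposite edge, whose reachable subline is `opp`: points must lie strictly above the lowest
reachable point of the opposite edge. -/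
noncomputable def fromOpposite (a b : ℝ) (opp : Option Subline) : Option Subline :=
  match opp with
  | none => none
  | some s =>
    if exact b ≤ s.lo then none
    else if exact a ≤ s.lo then mkSubline (addEps s.lo) (exact b)
    else mkSubline (exact a) (exact b)

open Classical in
/-- Reachable subline of one exit edge (right or top) of a cell.

`free` is the free part of the exit edge, `base` its lower end (its coordinate nearest to the
cell's lower left corner). `corner` says whether the lower left corner of the cell is reachable,
`opp` is the reachable subline of the edge opposite to the exit edge, and `adj` the one of the
other entry edge, which meets the exit edge in the point with `adj`-coordinate `far`.
For the right edge of cell `(i, j)`: `base = j`, `far = i + 1`, `opp` left, `adj` bottom.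
For the top edge: `base = i`, `far = j + 1`, `opp` bottom, `adj` left. -/
noncomputable def exitReach (free : Option (ℝ × ℝ)) (base far : ℝ) (corner : Prop)
    (opp adj : Option Subline) : Option Subline :=
  match free with
  | none => none
  | some (a, b) =>
    if corner then mkSubline (max (exact a) (plus base)) (exact b)
    else match adj with
      | none => fromOpposite a b opp
      | some s =>
        if s.lo < exact far then mkSubline (exact a) (exact b)
        else match fromOpposite a b opp with
          | some r => some r
          | none => some ⟨exact base, exact base⟩

/-- The reachability data that the dynamic program stores for a cell: whether its lower left
corner belongs to the corner set, and the reachable sublines of its four edges. -/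
structure CellReach where
  corner : Prop
  left : Option Subline
  bottom : Option Subline
  right : Option Subline
  top : Option Subline

/-- The data of cell `(i, j)` from its corner and its two entry edges. -/
noncomputable def mkCell (F : Set (ℝ × ℝ)) (i j : ℕ) (corner : Prop)
    (left bottom : Option Subline) : CellReach where
  corner := corner
  left := left
  bottom := bottom
  right := exitReach (freeVert F (i + 1) j) (j : ℝ) ((i : ℝ) + 1) corner left bottom
  top := exitReach (freeHor F i (j + 1)) (i : ℝ) ((j : ℝ) + 1) corner bottom left

open Classical in
/-- Left and bottom subline of cell `(0, 0)`. -/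
noncomputable def startSubline (F : Set (ℝ × ℝ)) : Option Subline :=
  if (0, 0) ∈ F then some ⟨exact 0, exact 0⟩ else none

/-- The upper end parameter of a subline equals `⟨d, ·⟩`. -/
def HiEq (s : Option Subline) (d : ℝ) : Prop := s.map Subline.hi = some (exact d)

/-- The dynamic program: the left subline of a cell is the right subline of its left neighbour,
the bottom subline is the top subline of its lower neighbour, and the corner `(i + 1, j + 1)` is
taken from the top and right sublines of cell `(i, j)`. -/
noncomputable def cellReach (F : Set (ℝ × ℝ)) : ℕ → ℕ → CellReach
  | 0, 0 => mkCell F 0 0 ((0, 0) ∈ F) (startSubline F) (startSubline F)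
  | i + 1, 0 => mkCell F (i + 1) 0 False (cellReach F i 0).right none
  | 0, j + 1 => mkCell F 0 (j + 1) False none (cellReach F 0 j).top
  | i + 1, j + 1 =>
    mkCell F (i + 1) (j + 1)
      (HiEq (cellReach F i j).top ((i : ℝ) + 1) ∨ HiEq (cellReach F i j).right ((j : ℝ) + 1))
      (cellReach F i (j + 1)).right (cellReach F (i + 1) j).top
termination_by i j => (i, j)

/-- The computed reachable portion of the top edge `[i, i + 1] × {j + 1}` of cell `(i, j)`: the
points of the computed subline, together with the left end point of the edge if that belongs to
the corner set. -/
def topReachablePortion (F : Set (ℝ × ℝ)) (i j : ℕ) : Set (ℝ × ℝ) :=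
  {p | p.2 = (j : ℝ) + 1 ∧
    ((∃ s ∈ (cellReach F i j).top, s.lo ≤ exact p.1 ∧ exact p.1 ≤ s.hi) ∨
      ((cellReach F i (j + 1)).corner ∧ p.1 = (i : ℝ)))}

/-- The right end parameter of the computed reachable subline of the top edge of cell `(i, j)`,
as a point (`none` is `⊥`). -/
noncomputable def topReachEnd (F : Set (ℝ × ℝ)) (i j : ℕ) : Option (EpsReal × EpsReal) :=
  (cellReach F i j).top.map fun s => (s.hi, exact ((j : ℝ) + 1))

end FrechetDecision

namespace FrechetDecision

/-! ### Coordinates -/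

/-! Only two properties of the free space matter: it is closed and it meets every cell in a convex
set (`IsCellwiseConvex`, proved in `isCellwiseConvex_freeSpace`). Hence a strictly increasing curve
ending at a free point `p` of a cell extends by a straight segment to every free point of that cell
lying strictly above and strictly to the right of `p` (`Reachable.step`).

Soundness (`entrySound`) is an induction over the cells showing that every recorded point is
reachable. The delicate point is the vertex where an exit edge meets the adjacent entry edge: no
strict step from that entry edge leads to it, so it is reachable only if the entry subline extends
up to it. The induction therefore also carries `left_hi` and `bottom_hi`. A recorded subline can
stop short of a free upper end only by being the single point produced by the exceptional branch of
the rule, and then that point is a recorded corner of the next cell.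

Completeness (`entryComplete`) follows a given curve: before it reaches an exit edge it enters the
open quadrant above the lower left corner of the cell through the left edge, the bottom edge or the
corner, and the rule passes this on. Applied to the last cell, both halves show that each condition
of the theorem says that the top subline has upper end `⟨mf, ·⟩`. -/

theorem exact_le_exact {a b : ℝ} : exact a ≤ exact b ↔ a ≤ b := by
  simp [exact, Prod.Lex.le_iff, ← le_iff_lt_or_eq]

theorem exact_inj {a b : ℝ} : exact a = exact b ↔ a = b := by
  simp [exact]

theorem lt_exact_iff {c : EpsReal} {a : ℝ} : c < exact a ↔ (ofLex c).1 < a := by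
  simp [exact, Prod.Lex.lt_iff]

theorem exact_le_iff {c : EpsReal} {a : ℝ} : exact a ≤ c ↔ a ≤ (ofLex c).1 := by
  rw [← not_lt, lt_exact_iff, not_lt]

theorem plus_le_exact {d y : ℝ} : plus d ≤ exact y ↔ d < y := by
  simp [plus, exact, Prod.Lex.toLex_le_toLex]

theorem addEps_le_exact {c : EpsReal} {y : ℝ} : addEps c ≤ exact y ↔ (ofLex c).1 < y :=
  plus_le_exact

theorem fst_le_of_le_exact {c : EpsReal} {y : ℝ} (h : c ≤ exact y) : (ofLex c).1 ≤ y := by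
  simp only [exact, Prod.Lex.le_iff, ofLex_toLex] at h
  rcases h with h | h
  exacts [h.le, h.1.le]

theorem le_exact_of_fst_lt {c : EpsReal} {y : ℝ} (h : (ofLex c).1 < y) : c ≤ exact y :=
  (lt_exact_iff.2 h).le

/-- A nonempty subline with an exact upper end has a point below every value that exceeds its
lower end. -/
theorem exists_lt_mem {c : EpsReal} {h y : ℝ} (hc : c ≤ exact h) (hy : (ofLex c).1 < y) :
    ∃ z < y, c ≤ exact z ∧ exact z ≤ exact h := by
  rcases lt_or_ge (ofLex c).1 h with hlt | hge
  · obtain ⟨z, hz, hz'⟩ := exists_between (lt_min hy hlt)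
    rw [lt_min_iff] at hz'
    exact ⟨z, hz'.1, le_exact_of_fst_lt hz, exact_le_exact.2 hz'.2.le⟩
  · exact ⟨h, hge.trans_lt hy, hc, le_rfl⟩

/-! ### The rule for an exit edge -/

theorem mem_mkSubline {lo hi : EpsReal} {s : Subline} (h : s ∈ mkSubline lo hi) :
    lo ≤ hi ∧ s.lo = lo ∧ s.hi = hi := by
  unfold mkSubline at h
  split_ifs at h with hle
  · cases h
    exact ⟨hle, rfl, rfl⟩
  · cases h

theorem mkSubline_of_le {lo hi c : EpsReal} (h₁ : lo ≤ c) (h₂ : c ≤ hi) :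
    mkSubline lo hi = some ⟨lo, hi⟩ :=
  if_pos (h₁.trans h₂)

theorem mem_fromOpposite {a b : ℝ} {opp : Option Subline} {s : Subline}
    (h : s ∈ fromOpposite a b opp) :
    s.hi = exact b ∧ s.lo ≤ exact b ∧ ∀ y, s.lo ≤ exact y →
      a ≤ y ∧ ∃ o ∈ opp, (ofLex o.lo).1 < y := by
  rcases opp with _ | o
  · cases h
  simp only [fromOpposite] at h
  split_ifs at h with h₁ h₂
  · cases h
  · obtain ⟨hle, hlo, hhi⟩ := mem_mkSubline h
    refine ⟨hhi, hlo ▸ hle, fun y hy => ?_⟩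
    rw [hlo, addEps_le_exact] at hy
    exact ⟨(exact_le_iff.1 h₂).trans hy.le, o, rfl, hy⟩
  · obtain ⟨hle, hlo, hhi⟩ := mem_mkSubline h
    refine ⟨hhi, hlo ▸ hle, fun y hy => ?_⟩
    rw [hlo, exact_le_exact] at hy
    exact ⟨hy, o, rfl, (lt_exact_iff.1 (not_le.1 h₂)).trans_le hy⟩

/-- All branches but one end at the exact value `b`, and each of their points is justified by the
corner, by a strictly lower parameter on the opposite edge, or by the adjacent edge. The remaining
alternative is the exceptional single point. -/
theorem mem_exitReach {a b base far : ℝ} {corner : Prop} {opp adj : Option Subline} {s : Subline}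
    (h : s ∈ exitReach (some (a, b)) base far corner opp adj) :
    (s.hi = exact b ∧ s.lo ≤ exact b ∧ ∀ y, s.lo ≤ exact y → a ≤ y ∧
      ((corner ∧ base < y) ∨ (∃ o ∈ opp, (ofLex o.lo).1 < y) ∨
        (¬ corner ∧ ∃ o ∈ adj, o.lo < exact far))) ∨
    (s = ⟨exact base, exact base⟩ ∧ ¬ corner ∧ ∃ o ∈ adj, exact far ≤ o.lo) := by
  unfold exitReach at h
  simp only at h
  split_ifs at h with hc
  · obtain ⟨hle, hlo, hhi⟩ := mem_mkSubline h
    refine Or.inl ⟨hhi, hlo ▸ hle, fun y hy => ?_⟩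
    rw [hlo, max_le_iff, exact_le_exact, plus_le_exact] at hy
    exact ⟨hy.1, Or.inl ⟨hc, hy.2⟩⟩
  · rcases adj with _ | o
    · obtain ⟨h₁, h₂, h₃⟩ := mem_fromOpposite h
      exact Or.inl ⟨h₁, h₂, fun y hy => ⟨(h₃ y hy).1, Or.inr (Or.inl (h₃ y hy).2)⟩⟩
    · simp only at h
      split_ifs at h with ho
      · obtain ⟨hle, hlo, hhi⟩ := mem_mkSubline h
        refine Or.inl ⟨hhi, hlo ▸ hle, fun y hy => ?_⟩
        rw [hlo, exact_le_exact] at hy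
        exact ⟨hy, Or.inr (Or.inr ⟨hc, o, rfl, ho⟩)⟩
      · rcases hS : fromOpposite a b opp with _ | r
        · rw [hS] at h
          cases h
          exact Or.inr ⟨rfl, hc, o, rfl, not_lt.1 ho⟩
        · rw [hS] at h
          cases h
          obtain ⟨h₁, h₂, h₃⟩ := mem_fromOpposite hS
          exact Or.inl ⟨h₁, h₂, fun y hy => ⟨(h₃ y hy).1, Or.inr (Or.inl (h₃ y hy).2)⟩⟩

/-- `Covers o y`: the subline `o` contains the point with coordinate `y`. -/
def Covers (o : Option Subline) (y : ℝ) : Prop :=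
  ∃ s ∈ o, s.lo ≤ exact y ∧ exact y ≤ s.hi

theorem covers_mkSubline {lo hi : EpsReal} {y : ℝ} (h₁ : lo ≤ exact y) (h₂ : exact y ≤ hi) :
    Covers (mkSubline lo hi) y :=
  ⟨_, mkSubline_of_le h₁ h₂, h₁, h₂⟩

theorem covers_fromOpposite {a b y z : ℝ} {opp : Option Subline} (hay : a ≤ y) (hyb : y ≤ b)
    (hz : Covers opp z) (hzy : z < y) : Covers (fromOpposite a b opp) y := by
  obtain ⟨o, ho, hlo, -⟩ := hz
  cases ho
  have hlt : (ofLex o.lo).1 < y := (fst_le_of_le_exact hlo).trans_lt hzy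
  simp only [fromOpposite]
  split_ifs with h₁ h₂
  · exact absurd (exact_le_iff.1 h₁) (not_le.2 (hlt.trans_le hyb))
  · exact covers_mkSubline (addEps_le_exact.2 hlt) (exact_le_exact.2 hyb)
  · exact covers_mkSubline (exact_le_exact.2 hay) (exact_le_exact.2 hyb)

theorem covers_exitReach {a b base far y : ℝ} {corner : Prop} {opp adj : Option Subline}
    (hay : a ≤ y) (hyb : y ≤ b) (hy : base < y)
    (h : corner ∨ (∃ z < y, Covers opp z) ∨ ∃ x < far, Covers adj x) :
    Covers (exitReach (some (a, b)) base far corner opp adj) y := by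
  unfold exitReach
  simp only
  split_ifs with hc
  · exact covers_mkSubline (max_le (exact_le_exact.2 hay) (plus_le_exact.2 hy))
      (exact_le_exact.2 hyb)
  rcases h with h | ⟨z, hz, hzo⟩ | ⟨x, hx, o, ho, hlo, -⟩
  · exact absurd h hc
  · have hS := covers_fromOpposite hay hyb hzo hz
    rcases adj with _ | o
    · exact hS
    · simp only
      split_ifs
      · exact covers_mkSubline (exact_le_exact.2 hay) (exact_le_exact.2 hyb)
      -- The opposite edge already yields a nonempty subline here, so the single-point branch does
      -- not occur.
      · obtain ⟨r, hr, hr'⟩ := hS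
        rw [Option.mem_def.1 hr]
        exact ⟨r, rfl, hr'⟩
  · cases ho
    simp only
    rw [if_pos (lt_exact_iff.2 ((fst_le_of_le_exact hlo).trans_lt hx))]
    exact covers_mkSubline (exact_le_exact.2 hay) (exact_le_exact.2 hyb)

/-! ### Free parts of edges -/

theorem endpoints_eq_some {S : Set ℝ} {a b : ℝ} (hS : IsCompact S) (h : endpoints S = some (a, b)) :
    a ∈ S ∧ b ∈ S ∧ ∀ y ∈ S, a ≤ y ∧ y ≤ b := by
  unfold endpoints at h
  split_ifs at h with hne
  cases h
  exact ⟨hS.sInf_mem hne, hS.sSup_mem hne,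
    fun y hy => ⟨csInf_le hS.bddBelow hy, le_csSup hS.bddAbove hy⟩⟩

theorem exists_endpoints {S : Set ℝ} {y : ℝ} (hy : y ∈ S) : ∃ a b, endpoints S = some (a, b) :=
  ⟨sInf S, sSup S, if_pos ⟨y, hy⟩⟩

/-! ### Soundness and completeness on one exit edge -/

/-- All points of a subline lie in `[base, base + 1]` and satisfy `P`, and its upper end is one
of them. -/
def SublineIn (P : ℝ → Prop) (base : ℝ) (o : Option Subline) : Prop :=
  ∀ s ∈ o, (∃ h, s.hi = exact h ∧ s.lo ≤ exact h) ∧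
    ∀ y, s.lo ≤ exact y → exact y ≤ s.hi → (base ≤ y ∧ y ≤ base + 1) ∧ P y

theorem SublineIn.none {P : ℝ → Prop} {base : ℝ} : SublineIn P base none := by
  intro s hs
  cases hs

theorem SublineIn.of_hi {P : ℝ → Prop} {base d : ℝ} {o : Option Subline} (h : SublineIn P base o)
    (hd : HiEq o d) : P d := by
  obtain ⟨s, hs, hsd⟩ := Option.map_eq_some_iff.1 hd
  obtain ⟨⟨c, hc, hlo⟩, hP⟩ := h s hs
  have : c = d := exact_inj.1 (hc.symm.trans hsd)
  subst this
  exact (hP c hlo hc.ge).2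

/-- Soundness keeps the upper end within the edge, so a subline that covers the end of the edge must
stop exactly there. This turns covering into the equality tested by the program. -/
theorem SublineIn.hiEq_of_covers {P : ℝ → Prop} {base : ℝ} {o : Option Subline}
    (h : SublineIn P base o) (hd : Covers o (base + 1)) : HiEq o (base + 1) := by
  obtain ⟨s, hs, -, hle⟩ := hd
  obtain ⟨⟨c, hc, hlo⟩, hP⟩ := h s hs
  have h₁ := (hP c hlo hc.ge).1.2
  rw [hc, exact_le_exact] at hle
  exact Option.map_eq_some_iff.2 ⟨s, hs, by rw [hc, le_antisymm h₁ hle]⟩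

variable {S : Set ℝ} {base base' : ℝ} {corner : Prop} {opp adj : Option Subline}
  {P Popp Padj : ℝ → Prop}

/-- One lemma serves right and top edges. `base` on the exit edge and `base' + 1` on the adjacent
edge name the same vertex, whence `hfar`; `hend` supplies that vertex when the rule declares the
whole free part reachable. -/
theorem sublineIn_exitReach (hS : IsCompact S) (hconv : S.OrdConnected)
    (hsub : S ⊆ Set.Icc base (base + 1))
    (hcorner : corner → ∀ y ∈ S, base < y → P y)
    (hopp : SublineIn Popp base opp) (hadj : SublineIn Padj base' adj)
    (hoppP : ∀ z, base ≤ z → Popp z → ∀ y ∈ S, z < y → P y)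
    (hadjP : ∀ x, base' ≤ x → x < base' + 1 → Padj x → ∀ y ∈ S, base < y → P y)
    (hfar : Padj (base' + 1) → P base)
    (hend : ¬ corner → base ∈ S → ∀ o ∈ adj, o.hi = exact (base' + 1)) :
    SublineIn P base (exitReach (endpoints S) base (base' + 1) corner opp adj) := by
  intro s hs
  rcases hab : endpoints S with _ | ⟨a, b⟩
  · rw [hab] at hs
    cases hs
  rw [hab] at hs
  obtain ⟨haS, hbS, -⟩ := endpoints_eq_some hS hab
  rcases mem_exitReach hs with ⟨hhi, hlo, hy⟩ | ⟨rfl, hc, o, ho, hle⟩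
  · refine ⟨⟨b, hhi, hlo⟩, fun y hly hyh => ?_⟩
    rw [hhi, exact_le_exact] at hyh
    obtain ⟨hay, hcases⟩ := hy y hly
    have hyS : y ∈ S := hconv.out haS hbS ⟨hay, hyh⟩
    refine ⟨hsub hyS, ?_⟩
    rcases hcases with ⟨hc, hby⟩ | ⟨o, ho, hoy⟩ | ⟨hc, o, ho, hlt⟩
    · exact hcorner hc y hyS hby
    · obtain ⟨⟨h, hh, hoh⟩, hP⟩ := hopp o ho
      obtain ⟨z, hzy, hz₁, hz₂⟩ := exists_lt_mem hoh hoy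
      obtain ⟨hz, hPz⟩ := hP z hz₁ (hh ▸ hz₂)
      exact hoppP z hz.1 hPz y hyS hzy
    · obtain ⟨⟨h, hh, hoh⟩, hP⟩ := hadj o ho
      rcases (hsub hyS).1.eq_or_lt with rfl | hby
      · have hhi' := hend hc hyS o ho
        exact hfar (hP _ hlt.le hhi'.ge).2
      · obtain ⟨x, hxf, hx₁, hx₂⟩ := exists_lt_mem hoh (lt_exact_iff.1 hlt)
        obtain ⟨hx, hPx⟩ := hP x hx₁ (hh ▸ hx₂)
        exact hadjP x hx.1 hxf hPx y hyS hby
  · refine ⟨⟨base, rfl, le_rfl⟩, fun y h₁ h₂ => ?_⟩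
    obtain rfl := le_antisymm (exact_le_exact.1 h₁) (exact_le_exact.1 h₂)
    refine ⟨⟨le_rfl, by linarith⟩, hfar ?_⟩
    obtain ⟨⟨h, hh, hoh⟩, hP⟩ := hadj o ho
    have h₃ := (hP h hoh hh.ge).1.2
    have h₄ := exact_le_exact.1 (hle.trans hoh)
    -- The adjacent subline lies in its edge yet starts no lower than the far end, so it is that
    -- vertex alone.
    obtain rfl := le_antisymm h₃ h₄
    exact (hP _ hoh hh.ge).2

/-- If the upper end of the exit edge is free, it is the `b` of the ordinary branches. Only the
single-point branch can end elsewhere, and it forces the adjacent subline to end at the shared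
vertex. -/
theorem exitReach_hi (hS : IsCompact S) (hsub : S ⊆ Set.Icc base (base + 1))
    (hadj : SublineIn Padj base' adj) (hmem : base + 1 ∈ S)
    {s : Subline} (hs : s ∈ exitReach (endpoints S) base (base' + 1) corner opp adj) :
    s.hi = exact (base + 1) ∨ (¬ corner ∧ HiEq adj (base' + 1)) := by
  rcases hab : endpoints S with _ | ⟨a, b⟩
  · rw [hab] at hs
    cases hs
  rw [hab] at hs
  obtain ⟨-, hbS, hall⟩ := endpoints_eq_some hS hab
  have hb : b = base + 1 := le_antisymm (hsub hbS).2 (hall _ hmem).2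
  rcases mem_exitReach hs with ⟨hhi, -, -⟩ | ⟨-, hc, o, ho, hle⟩
  · exact Or.inl (hb ▸ hhi)
  · obtain ⟨⟨h, hh, hoh⟩, hP⟩ := hadj o ho
    have h₃ := (hP h hoh hh.ge).1.2
    have h₄ := exact_le_exact.1 (hle.trans hoh)
    exact Or.inr ⟨hc, Option.map_eq_some_iff.2 ⟨o, ho, by rw [hh, le_antisymm h₃ h₄]⟩⟩

theorem covers_exitReach_endpoints (hS : IsCompact S) {far y : ℝ} (hyS : y ∈ S) (hy : base < y)
    (h : corner ∨ (∃ z < y, Covers opp z) ∨ ∃ x < far, Covers adj x) :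
    Covers (exitReach (endpoints S) base far corner opp adj) y := by
  obtain ⟨a, b, hab⟩ := exists_endpoints hyS
  obtain ⟨-, -, hall⟩ := endpoints_eq_some hS hab
  rw [hab]
  exact covers_exitReach (hall y hyS).1 (hall y hyS).2 hy h

end FrechetDecision

namespace FrechetDecision

/-! ### Strictly increasing curves as graphs -/

/-- `q` lies on a strictly increasing curve in `F` that starts in the origin, given as the graph
of a function. -/
def Reachable (F : Set (ℝ × ℝ)) (q : ℝ × ℝ) : Prop :=
  q ∈ F ∧ 0 ≤ q.1 ∧ ∃ h : ℝ → ℝ, ContinuousOn h (Set.Icc 0 q.1) ∧ StrictMonoOn h (Set.Icc 0 q.1) ∧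
    h 0 = 0 ∧ h q.1 = q.2 ∧ ∀ x ∈ Set.Icc 0 q.1, (x, h x) ∈ F

variable {F : Set (ℝ × ℝ)}

theorem Reachable.origin (h : (0, 0) ∈ F) : Reachable F (0, 0) := by
  refine ⟨h, le_rfl, id, continuousOn_id, strictMonoOn_id, rfl, rfl, fun x hx => ?_⟩
  obtain rfl : x = 0 := le_antisymm hx.2 hx.1
  exact h

/-- With curves as graphs, concatenation is gluing of functions at `p.1` and needs no
reparametrization; the new piece has positive slope `c`. -/
theorem Reachable.extend {p q : ℝ × ℝ} (hp : Reachable F p) (h₁ : p.1 < q.1) (h₂ : p.2 < q.2)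
    (hseg : segment ℝ p q ⊆ F) : Reachable F q := by
  obtain ⟨-, hp0, h, hcont, hmono, h0, hp2, hF⟩ := hp
  set c : ℝ := (q.2 - p.2) / (q.1 - p.1) with hc
  have hcpos : 0 < c := div_pos (sub_pos.2 h₂) (sub_pos.2 h₁)
  set l : ℝ → ℝ := fun x => p.2 + c * (x - p.1) with hl
  set k : ℝ → ℝ := fun x => if x ≤ p.1 then h x else l x with hk
  have hkh : Set.EqOn k h (Set.Icc 0 p.1) := fun x hx => if_pos hx.2
  have hkl : Set.EqOn k l (Set.Icc p.1 q.1) := fun x hx => by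
    rcases hx.1.eq_or_lt with rfl | hlt
    · simp [hk, hl, hp2]
    · exact if_neg (not_le.2 hlt)
  have hunion : Set.Icc 0 p.1 ∪ Set.Icc p.1 q.1 = Set.Icc 0 q.1 :=
    Set.Icc_union_Icc_eq_Icc hp0 h₁.le
  have hq2 : l q.1 = q.2 := by
    simp only [hl, hc]
    rw [div_mul_cancel₀ _ (sub_pos.2 h₁).ne']
    ring
  refine ⟨hseg (right_mem_segment ℝ p q), hp0.trans h₁.le, k, ?_, ?_, ?_, ?_, ?_⟩
  · rw [← hunion]
    refine ContinuousOn.union_of_isClosed (hcont.congr hkh) ?_ isClosed_Icc isClosed_Icc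
    exact ContinuousOn.congr (by fun_prop) hkl
  · rw [← hunion]
    refine StrictMonoOn.union (hmono.congr hkh.symm) (StrictMonoOn.congr ?_ hkl.symm)
      (isGreatest_Icc hp0) (isLeast_Icc h₁.le)
    intro x _ y _ hxy
    have := mul_lt_mul_of_pos_left (sub_lt_sub_right hxy p.1) hcpos
    simpa only [hl, add_lt_add_iff_left] using this
  · rw [hkh ⟨le_rfl, hp0⟩, h0]
  · rw [hkl ⟨h₁.le, le_rfl⟩, hq2]
  · intro x hx
    rcases le_total x p.1 with hxp | hxp
    · rw [hkh ⟨hx.1, hxp⟩]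
      exact hF x ⟨hx.1, hxp⟩
    · rw [hkl ⟨hxp, hx.2⟩]
      apply hseg
      have hne := (sub_pos.2 h₁).ne'
      rw [segment_eq_image']
      refine ⟨(x - p.1) / (q.1 - p.1), ⟨div_nonneg (sub_nonneg.2 hxp) (sub_pos.2 h₁).le,
        div_le_one_of_le₀ (by linarith [hx.2]) (sub_pos.2 h₁).le⟩, ?_⟩
      ext
      · simp only [Prod.fst_add, Prod.smul_fst, Prod.fst_sub, smul_eq_mul]
        field_simp
        ring
      · simp only [Prod.snd_add, Prod.smul_snd, Prod.snd_sub, smul_eq_mul, hl, hc]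
        field_simp

theorem Reachable.exists_curve {q : ℝ × ℝ} (h : Reachable F q) (hq : 0 < q.1) :
    ∃ α : unitInterval → ℝ × ℝ, IsStrictMonoCurve F (0, 0) q α := by
  obtain ⟨-, -, h, hcont, hmono, h0, h1, hF⟩ := h
  have hmem : ∀ t : unitInterval, q.1 * (t : ℝ) ∈ Set.Icc 0 q.1 := fun t =>
    ⟨mul_nonneg hq.le t.2.1, mul_le_of_le_one_right hq.le t.2.2⟩
  have hlt : StrictMono fun t : unitInterval => q.1 * (t : ℝ) := fun s t hst =>
    mul_lt_mul_of_pos_left hst hq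
  refine ⟨fun t => (q.1 * t, h (q.1 * t)), ?_, hlt, fun s t hst => hmono (hmem s) (hmem t) (hlt hst),
    fun t => hF _ (hmem t), ?_, ?_⟩
  · have h₁ : Continuous fun t : unitInterval => q.1 * (t : ℝ) := by fun_prop
    exact h₁.prodMk (hcont.comp_continuous h₁ hmem)
  · simp [h0]
  · simp [h1]

/-- The entry point of a strictly increasing curve into the quadrant above `(a, b)`. -/
theorem IsStrictMonoCurve.exists_entry {q : ℝ × ℝ} {α : unitInterval → ℝ × ℝ}
    (hα : IsStrictMonoCurve F (0, 0) q α) {a b : ℝ} (ha : 0 ≤ a) (hb : 0 ≤ b) {t : unitInterval}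
    (h₁ : a < (α t).1) (h₂ : b < (α t).2) :
    ∃ s < t, α s = (a, b) ∨ ((α s).1 = a ∧ b < (α s).2) ∨ ((α s).2 = b ∧ a < (α s).1) := by
  have hivt : ∀ u : unitInterval → ℝ, Continuous u → ∀ c, u 0 ≤ c → c < u t → ∃ s < t, u s = c := by
    intro u hu c h0 hc
    obtain ⟨s, hs, rfl⟩ := intermediate_value_Icc (unitInterval.nonneg' (t := t))
      hu.continuousOn ⟨h0, hc.le⟩
    refine ⟨s, hs.2.lt_of_ne ?_, rfl⟩
    rintro rfl
    exact lt_irrefl _ hc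
  have h0 : α 0 = (0, 0) := hα.source
  obtain ⟨s₁, hs₁, rfl⟩ := hivt (fun t => (α t).1) hα.continuous.fst a (by simpa [h0] using ha) h₁
  obtain ⟨s₂, hs₂, rfl⟩ := hivt (fun t => (α t).2) hα.continuous.snd b (by simpa [h0] using hb) h₂
  -- The later of the two crossing times is the entry time; equality means entry through the corner.
  rcases lt_trichotomy s₁ s₂ with h | rfl | h
  · exact ⟨s₂, hs₂, Or.inr (Or.inr ⟨rfl, hα.strictMono_fst h⟩)⟩
  · exact ⟨s₁, hs₁, Or.inl rfl⟩
  · exact ⟨s₁, hs₁, Or.inr (Or.inl ⟨rfl, hα.strictMono_snd h⟩)⟩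

/-! ### Regions that are convex in every cell -/

/-- A closed subset of `[0, mf] × [0, mg]` whose intersection with every cell is convex. -/
structure IsCellwiseConvex (mf mg : ℕ) (F : Set (ℝ × ℝ)) : Prop where
  isClosed : IsClosed F
  convex : ∀ i < mf, ∀ j < mg,
    Convex ℝ (F ∩ Set.Icc ((i : ℝ), (j : ℝ)) ((i : ℝ) + 1, (j : ℝ) + 1))

variable {mf mg i j : ℕ}

theorem IsCellwiseConvex.segment_subset (hF : IsCellwiseConvex mf mg F) (hi : i < mf) (hj : j < mg)
    {p q : ℝ × ℝ} (hp : p ∈ F) (hq : q ∈ F)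
    (hp' : p ∈ Set.Icc ((i : ℝ), (j : ℝ)) ((i : ℝ) + 1, (j : ℝ) + 1))
    (hq' : q ∈ Set.Icc ((i : ℝ), (j : ℝ)) ((i : ℝ) + 1, (j : ℝ) + 1)) : segment ℝ p q ⊆ F :=
  ((hF.convex i hi j hj).segment_subset ⟨hp, hp'⟩ ⟨hq, hq'⟩).trans Set.inter_subset_left

theorem isCompact_vert (hF : IsClosed F) (x c : ℝ) :
    IsCompact {y | y ∈ Set.Icc c (c + 1) ∧ (x, y) ∈ F} :=
  isCompact_Icc.inter_right (hF.preimage (by fun_prop : Continuous fun y : ℝ => (x, y)))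

theorem isCompact_hor (hF : IsClosed F) (y c : ℝ) :
    IsCompact {x | x ∈ Set.Icc c (c + 1) ∧ (x, y) ∈ F} :=
  isCompact_Icc.inter_right (hF.preimage (by fun_prop : Continuous fun x : ℝ => (x, y)))

theorem IsCellwiseConvex.ordConnected_vert (hF : IsCellwiseConvex mf mg F) (hi : i < mf)
    (hj : j < mg) :
    {y | y ∈ Set.Icc (j : ℝ) ((j : ℝ) + 1) ∧ ((i : ℝ) + 1, y) ∈ F}.OrdConnected := by
  refine ⟨fun y hy z hz w hw => ⟨⟨hy.1.1.trans hw.1, hw.2.trans hz.1.2⟩, ?_⟩⟩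
  have hmem : ∀ y ∈ Set.Icc (j : ℝ) ((j : ℝ) + 1),
      ((i : ℝ) + 1, y) ∈ Set.Icc ((i : ℝ), (j : ℝ)) ((i : ℝ) + 1, (j : ℝ) + 1) := fun y hy =>
    ⟨⟨by simp, hy.1⟩, ⟨le_rfl, hy.2⟩⟩
  refine hF.segment_subset hi hj hy.2 hz.2 (hmem y hy.1) (hmem z hz.1) ?_
  rw [← Prod.image_mk_segment_right, segment_eq_Icc (hw.1.trans hw.2)]
  exact ⟨w, hw, rfl⟩

theorem IsCellwiseConvex.ordConnected_hor (hF : IsCellwiseConvex mf mg F) (hi : i < mf)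
    (hj : j < mg) :
    {x | x ∈ Set.Icc (i : ℝ) ((i : ℝ) + 1) ∧ (x, (j : ℝ) + 1) ∈ F}.OrdConnected := by
  refine ⟨fun y hy z hz w hw => ⟨⟨hy.1.1.trans hw.1, hw.2.trans hz.1.2⟩, ?_⟩⟩
  have hmem : ∀ x ∈ Set.Icc (i : ℝ) ((i : ℝ) + 1),
      (x, (j : ℝ) + 1) ∈ Set.Icc ((i : ℝ), (j : ℝ)) ((i : ℝ) + 1, (j : ℝ) + 1) := fun x hx =>
    ⟨⟨hx.1, by simp⟩, ⟨hx.2, le_rfl⟩⟩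
  refine hF.segment_subset hi hj hy.2 hz.2 (hmem y hy.1) (hmem z hz.1) ?_
  rw [← Prod.image_mk_segment_left, segment_eq_Icc (hw.1.trans hw.2)]
  exact ⟨w, hw, rfl⟩

/-- One step of a strictly increasing curve inside a cell. -/
theorem Reachable.step (hF : IsCellwiseConvex mf mg F) (hi : i < mf) (hj : j < mg) {p q : ℝ × ℝ}
    (hp : Reachable F p) (hq : q ∈ F) (hpi : (i : ℝ) ≤ p.1) (hpj : (j : ℝ) ≤ p.2)
    (hqi : q.1 ≤ (i : ℝ) + 1) (hqj : q.2 ≤ (j : ℝ) + 1) (h₁ : p.1 < q.1) (h₂ : p.2 < q.2) :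
    Reachable F q :=
  hp.extend h₁ h₂ (hF.segment_subset hi hj hp.1 hq
    ⟨⟨hpi, hpj⟩, ⟨h₁.le.trans hqi, h₂.le.trans hqj⟩⟩ ⟨⟨hpi.trans h₁.le, hpj.trans h₂.le⟩, ⟨hqi, hqj⟩⟩)

/-! ### Free spaces are cellwise convex -/

/-- On `[i, i + 1]` a polygonal curve respects convex combinations. -/
theorem IsPolygonalCurve.map_combo {E : Type*} [NormedAddCommGroup E] [NormedSpace ℝ E] {m : ℕ}
    {f : ℝ → E} (hf : IsPolygonalCurve m f) (hi : i < m) {x y a b : ℝ}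
    (hx : x ∈ Set.Icc (i : ℝ) ((i : ℝ) + 1)) (hy : y ∈ Set.Icc (i : ℝ) ((i : ℝ) + 1))
    (ha : 0 ≤ a) (hb : 0 ≤ b) (hab : a + b = 1) :
    f (a * x + b * y) = a • f x + b • f y := by
  have key : ∀ z ∈ Set.Icc (i : ℝ) ((i : ℝ) + 1),
      f z = (1 - (z - i)) • f (i : ℝ) + (z - i) • f ((i : ℝ) + 1) := fun z hz => by
    have := hf.interp i hi (z - i) ⟨sub_nonneg.2 hz.1, by linarith [hz.2]⟩
    rwa [add_sub_cancel] at this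
  have hmem := convex_Icc (i : ℝ) ((i : ℝ) + 1) hx hy ha hb hab
  simp only [smul_eq_mul] at hmem
  obtain rfl : b = 1 - a := by linarith
  rw [key _ hmem, key x hx, key y hy]
  module

theorem isCellwiseConvex_freeSpace {E : Type*} [NormedAddCommGroup E] [NormedSpace ℝ E]
    {f g : ℝ → E} (hf : IsPolygonalCurve mf f) (hg : IsPolygonalCurve mg g) (δ : ℝ) :
    IsCellwiseConvex mf mg (freeSpace mf mg f g δ) where
  isClosed := by
    have hcont : ContinuousOn (fun p : ℝ × ℝ => ‖f p.1 - g p.2‖)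
        (Set.Icc 0 (mf : ℝ) ×ˢ Set.Icc 0 (mg : ℝ)) :=
      ((hf.continuousOn.comp continuousOn_fst fun p hp => hp.1).sub
        (hg.continuousOn.comp continuousOn_snd fun p hp => hp.2)).norm
    have := hcont.preimage_isClosed_of_isClosed (isClosed_Icc.prod isClosed_Icc)
      (isClosed_Iic (a := δ))
    convert this using 1
    ext p
    simp only [freeSpace, Set.mem_ofPred_eq, Set.mem_inter_iff, Set.mem_prod, Set.mem_preimage,
      Set.mem_Iic, and_assoc]
  convex i hi j hj := by
    rintro p ⟨⟨hp₁, hp₂, hp⟩, hpc⟩ q ⟨⟨hq₁, hq₂, hq⟩, hqc⟩ a b ha hb hab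
    refine ⟨⟨convex_Icc _ _ hp₁ hq₁ ha hb hab, convex_Icc _ _ hp₂ hq₂ ha hb hab, ?_⟩,
      convex_Icc _ _ hpc hqc ha hb hab⟩
    have h₁ := hf.map_combo hi ⟨hpc.1.1, hpc.2.1⟩ ⟨hqc.1.1, hqc.2.1⟩ ha hb hab
    have h₂ := hg.map_combo hj ⟨hpc.1.2, hpc.2.2⟩ ⟨hqc.1.2, hqc.2.2⟩ ha hb hab
    simp only [Prod.fst_add, Prod.smul_fst, Prod.snd_add, Prod.smul_snd, smul_eq_mul]
    -- On a cell the difference of the two curves respects convex combinations, so convexity of the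
    -- ball of radius `δ` applies.
    rw [h₁, h₂, show a • f p.1 + b • f q.1 - (a • g p.2 + b • g q.2) =
      a • (f p.1 - g p.2) + b • (f q.1 - g q.2) by module]
    have := convex_closedBall (0 : E) δ (mem_closedBall_zero_iff.2 hp) (mem_closedBall_zero_iff.2 hq)
      ha hb hab
    exact mem_closedBall_zero_iff.1 this

end FrechetDecision

namespace FrechetDecision

/-! ### The dynamic program -/

variable {F : Set (ℝ × ℝ)} {mf mg i j : ℕ}

/-- This form is uniform in the four cases of the recursion, so the exit rule can be treated without
case distinction. -/
theorem right_cellReach (F : Set (ℝ × ℝ)) (i j : ℕ) :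
    (cellReach F i j).right =
      exitReach (endpoints {y | y ∈ Set.Icc (j : ℝ) ((j : ℝ) + 1) ∧ ((i : ℝ) + 1, y) ∈ F})
        (j : ℝ) ((i : ℝ) + 1) (cellReach F i j).corner (cellReach F i j).left
        (cellReach F i j).bottom := by
  rcases i with _ | i <;> rcases j with _ | j <;> simp [cellReach, mkCell, freeVert]

theorem top_cellReach (F : Set (ℝ × ℝ)) (i j : ℕ) :
    (cellReach F i j).top =
      exitReach (endpoints {x | x ∈ Set.Icc (i : ℝ) ((i : ℝ) + 1) ∧ (x, (j : ℝ) + 1) ∈ F})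
        (i : ℝ) ((j : ℝ) + 1) (cellReach F i j).corner (cellReach F i j).bottom
        (cellReach F i j).left := by
  rcases i with _ | i <;> rcases j with _ | j <;> simp [cellReach, mkCell, freeHor]

theorem left_cellReach_succ (F : Set (ℝ × ℝ)) (i j : ℕ) :
    (cellReach F (i + 1) j).left = (cellReach F i j).right := by
  rcases j with _ | j <;> rw [cellReach] <;> rfl

theorem bottom_cellReach_succ (F : Set (ℝ × ℝ)) (i j : ℕ) :
    (cellReach F i (j + 1)).bottom = (cellReach F i j).top := by
  rcases i with _ | i <;> rw [cellReach] <;> rfl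

theorem corner_cellReach_succ (F : Set (ℝ × ℝ)) (i j : ℕ) :
    (cellReach F (i + 1) (j + 1)).corner =
      (HiEq (cellReach F i j).top ((i : ℝ) + 1) ∨ HiEq (cellReach F i j).right ((j : ℝ) + 1)) := by
  rw [cellReach]
  rfl

theorem corner_cellReach_zero (F : Set (ℝ × ℝ)) : (cellReach F 0 0).corner = ((0, 0) ∈ F) := by
  rw [cellReach]
  rfl

theorem corner_cellReach_succ_zero (F : Set (ℝ × ℝ)) (i : ℕ) :
    (cellReach F (i + 1) 0).corner = False := by
  rw [cellReach]
  rfl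

theorem corner_cellReach_zero_succ (F : Set (ℝ × ℝ)) (j : ℕ) :
    (cellReach F 0 (j + 1)).corner = False := by
  rw [cellReach]
  rfl

theorem left_cellReach_zero (F : Set (ℝ × ℝ)) : (cellReach F 0 0).left = startSubline F := by
  rw [cellReach]
  rfl

theorem bottom_cellReach_zero (F : Set (ℝ × ℝ)) : (cellReach F 0 0).bottom = startSubline F := by
  rw [cellReach]
  rfl

theorem left_cellReach_zero_succ (F : Set (ℝ × ℝ)) (j : ℕ) :
    (cellReach F 0 (j + 1)).left = none := by
  rw [cellReach]
  rfl

theorem bottom_cellReach_succ_zero (F : Set (ℝ × ℝ)) (i : ℕ) :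
    (cellReach F (i + 1) 0).bottom = none := by
  rw [cellReach]
  rfl

/-! ### Soundness of the recorded data -/

/-- The corner and the entry sublines of cell `(i, j)` consist of reachable points, and an entry
subline whose upper end is free extends up to it unless the corner is recorded. -/
structure EntrySound (F : Set (ℝ × ℝ)) (i j : ℕ) : Prop where
  corner : (cellReach F i j).corner → Reachable F (i, j)
  left : SublineIn (fun y => Reachable F (i, y)) j (cellReach F i j).left
  bottom : SublineIn (fun x => Reachable F (x, j)) i (cellReach F i j).bottom
  left_hi : ¬ (cellReach F i j).corner → ((i : ℝ), (j : ℝ) + 1) ∈ F →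
    ∀ o ∈ (cellReach F i j).left, o.hi = exact ((j : ℝ) + 1)
  bottom_hi : ¬ (cellReach F i j).corner → ((i : ℝ) + 1, (j : ℝ)) ∈ F →
    ∀ o ∈ (cellReach F i j).bottom, o.hi = exact ((i : ℝ) + 1)

theorem EntrySound.right (h : EntrySound F i j) (hF : IsCellwiseConvex mf mg F) (hi : i < mf)
    (hj : j < mg) :
    SublineIn (fun y => Reachable F ((i : ℝ) + 1, y)) j (cellReach F i j).right := by
  rw [right_cellReach]
  refine sublineIn_exitReach (isCompact_vert hF.isClosed _ _) (hF.ordConnected_vert hi hj)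
    (fun y hy => hy.1) ?_ h.left h.bottom ?_ ?_ id ?_
  · intro hc y hy hlt
    exact (h.corner hc).step hF hi hj hy.2 le_rfl le_rfl le_rfl hy.1.2 (lt_add_one _) hlt
  · intro z hz hR y hy hzy
    exact hR.step hF hi hj hy.2 le_rfl hz le_rfl hy.1.2 (lt_add_one _) hzy
  · intro x hx hxf hR y hy hlt
    exact hR.step hF hi hj hy.2 hx le_rfl le_rfl hy.1.2 hxf hlt
  · exact fun hc hmem => h.bottom_hi hc hmem.2

theorem EntrySound.top (h : EntrySound F i j) (hF : IsCellwiseConvex mf mg F) (hi : i < mf)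
    (hj : j < mg) :
    SublineIn (fun x => Reachable F (x, (j : ℝ) + 1)) i (cellReach F i j).top := by
  rw [top_cellReach]
  refine sublineIn_exitReach (isCompact_hor hF.isClosed _ _) (hF.ordConnected_hor hi hj)
    (fun y hy => hy.1) ?_ h.bottom h.left ?_ ?_ id ?_
  · intro hc y hy hlt
    exact (h.corner hc).step hF hi hj hy.2 le_rfl le_rfl hy.1.2 le_rfl hlt (lt_add_one _)
  · intro z hz hR y hy hzy
    exact hR.step hF hi hj hy.2 hz le_rfl hy.1.2 le_rfl hzy (lt_add_one _)
  · intro x hx hxf hR y hy hlt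
    exact hR.step hF hi hj hy.2 le_rfl hx hy.1.2 le_rfl hlt hxf
  · exact fun hc hmem => h.left_hi hc hmem.2

theorem EntrySound.right_hi (h : EntrySound F i j) (hF : IsClosed F)
    (hmem : ((i : ℝ) + 1, (j : ℝ) + 1) ∈ F) :
    ∀ o ∈ (cellReach F i j).right, o.hi = exact ((j : ℝ) + 1) ∨
      (¬ (cellReach F i j).corner ∧ HiEq (cellReach F i j).bottom ((i : ℝ) + 1)) := by
  rw [right_cellReach]
  exact fun o ho => exitReach_hi (isCompact_vert hF _ _) (fun y hy => hy.1) h.bottom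
    ⟨⟨by simp, le_rfl⟩, hmem⟩ ho

theorem EntrySound.top_hi (h : EntrySound F i j) (hF : IsClosed F)
    (hmem : ((i : ℝ) + 1, (j : ℝ) + 1) ∈ F) :
    ∀ o ∈ (cellReach F i j).top, o.hi = exact ((i : ℝ) + 1) ∨
      (¬ (cellReach F i j).corner ∧ HiEq (cellReach F i j).left ((j : ℝ) + 1)) := by
  rw [top_cellReach]
  exact fun o ho => exitReach_hi (isCompact_hor hF _ _) (fun y hy => hy.1) h.left
    ⟨⟨by simp, le_rfl⟩, hmem⟩ ho

theorem mem_startSubline {o : Subline} (h : o ∈ startSubline F) :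
    (0, 0) ∈ F ∧ o = ⟨exact 0, exact 0⟩ := by
  unfold startSubline at h
  split_ifs at h with h0
  · cases h
    exact ⟨h0, rfl⟩
  · cases h

theorem sublineIn_startSubline {P : ℝ → Prop} (h : (0, 0) ∈ F → P 0) :
    SublineIn P 0 (startSubline F) := by
  intro o ho
  obtain ⟨h0, rfl⟩ := mem_startSubline ho
  refine ⟨⟨0, rfl, le_rfl⟩, fun y h₁ h₂ => ?_⟩
  obtain rfl := le_antisymm (exact_le_exact.1 h₁) (exact_le_exact.1 h₂)
  exact ⟨⟨le_rfl, by norm_num⟩, h h0⟩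

theorem HiEq.none {d : ℝ} : ¬ HiEq none d := by
  simp [HiEq]

theorem entrySound (hF : IsCellwiseConvex mf mg F) :
    ∀ i j : ℕ, i < mf → j < mg → EntrySound F i j
  | 0, 0, _, _ =>
    { corner := fun h => by
        rw [corner_cellReach_zero] at h
        simpa using Reachable.origin h
      left := by
        rw [left_cellReach_zero, Nat.cast_zero]
        exact sublineIn_startSubline Reachable.origin
      bottom := by
        rw [bottom_cellReach_zero, Nat.cast_zero]
        exact sublineIn_startSubline Reachable.origin
      left_hi := fun hc _ o ho => by
        rw [left_cellReach_zero] at ho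
        rw [corner_cellReach_zero] at hc
        exact absurd (mem_startSubline ho).1 hc
      bottom_hi := fun hc _ o ho => by
        rw [bottom_cellReach_zero] at ho
        rw [corner_cellReach_zero] at hc
        exact absurd (mem_startSubline ho).1 hc }
  | i + 1, 0, hi, hj => by
    have ih := entrySound hF i 0 (Nat.lt_of_succ_lt hi) hj
    refine ⟨fun h => ?_, ?_, ?_, fun _ hmem o ho => ?_, fun _ _ o ho => ?_⟩
    · rw [corner_cellReach_succ_zero] at h
      exact h.elim
    · rw [left_cellReach_succ, Nat.cast_succ]
      exact ih.right hF (Nat.lt_of_succ_lt hi) hj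
    · rw [bottom_cellReach_succ_zero]
      exact SublineIn.none
    · rw [left_cellReach_succ] at ho
      rw [Nat.cast_succ] at hmem
      -- In the lowest row the exception needs a nonempty bottom subline. Only cell `(0, 0)` can
      -- have one, and then its corner is recorded.
      refine (ih.right_hi hF.isClosed hmem o ho).resolve_right ?_
      rintro ⟨hc, hb⟩
      rcases i with _ | i
      · obtain ⟨s, hs, -⟩ := Option.map_eq_some_iff.1 hb
        rw [bottom_cellReach_zero] at hs
        rw [corner_cellReach_zero] at hc
        exact hc (mem_startSubline hs).1
      · rw [bottom_cellReach_succ_zero] at hb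
        exact HiEq.none hb
    · rw [bottom_cellReach_succ_zero] at ho
      cases ho
  | 0, j + 1, hi, hj => by
    have ih := entrySound hF 0 j hi (Nat.lt_of_succ_lt hj)
    refine ⟨fun h => ?_, ?_, ?_, fun _ _ o ho => ?_, fun _ hmem o ho => ?_⟩
    · rw [corner_cellReach_zero_succ] at h
      exact h.elim
    · rw [left_cellReach_zero_succ]
      exact SublineIn.none
    · rw [bottom_cellReach_succ, Nat.cast_succ]
      exact ih.top hF hi (Nat.lt_of_succ_lt hj)
    · rw [left_cellReach_zero_succ] at ho
      cases ho
    · rw [bottom_cellReach_succ] at ho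
      rw [Nat.cast_succ] at hmem
      refine (ih.top_hi hF.isClosed hmem o ho).resolve_right ?_
      rintro ⟨hc, hb⟩
      rcases j with _ | j
      · obtain ⟨s, hs, -⟩ := Option.map_eq_some_iff.1 hb
        rw [left_cellReach_zero] at hs
        rw [corner_cellReach_zero] at hc
        exact hc (mem_startSubline hs).1
      · rw [left_cellReach_zero_succ] at hb
        exact HiEq.none hb
  | i + 1, j + 1, hi, hj => by
    have hi' := Nat.lt_of_succ_lt hi
    have hj' := Nat.lt_of_succ_lt hj
    have ih := entrySound hF i j hi' hj'
    have ihl := entrySound hF i (j + 1) hi' hj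
    have ihb := entrySound hF (i + 1) j hi hj'
    refine ⟨fun h => ?_, ?_, ?_, fun hc hmem o ho => ?_, fun hc hmem o ho => ?_⟩
    · rw [corner_cellReach_succ] at h
      rw [Nat.cast_succ, Nat.cast_succ]
      exact h.elim (ih.top hF hi' hj').of_hi (ih.right hF hi' hj').of_hi
    · rw [left_cellReach_succ, Nat.cast_succ]
      exact ihl.right hF hi' hj
    · rw [bottom_cellReach_succ, Nat.cast_succ]
      exact ihb.top hF hi hj'
    · rw [left_cellReach_succ] at ho
      rw [Nat.cast_succ i] at hmem
      -- In the exceptional case the top subline of cell `(i, j)` ends at the vertex `(i + 1, j +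
      -- 1)`, which would put it in the corner set.
      refine (ihl.right_hi hF.isClosed hmem o ho).resolve_right ?_
      rintro ⟨-, hb⟩
      rw [bottom_cellReach_succ] at hb
      rw [corner_cellReach_succ] at hc
      exact hc (Or.inl hb)
    · rw [bottom_cellReach_succ] at ho
      rw [Nat.cast_succ j] at hmem
      refine (ihb.top_hi hF.isClosed hmem o ho).resolve_right ?_
      rintro ⟨-, hb⟩
      rw [left_cellReach_succ] at hb
      rw [corner_cellReach_succ] at hc
      exact hc (Or.inr hb)

/-! ### Completeness along a given curve -/

/-- Every point of `α` on the entry edges of cell `(i, j)` is recorded. -/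
structure EntryComplete (F : Set (ℝ × ℝ)) (α : unitInterval → ℝ × ℝ) (i j : ℕ) : Prop where
  corner : ∀ t, α t = ((i : ℝ), (j : ℝ)) → (cellReach F i j).corner
  left : ∀ t, (α t).1 = i → j < (α t).2 → (α t).2 ≤ j + 1 →
    Covers (cellReach F i j).left (α t).2
  bottom : ∀ t, (α t).2 = j → i < (α t).1 → (α t).1 ≤ i + 1 →
    Covers (cellReach F i j).bottom (α t).1

variable {α : unitInterval → ℝ × ℝ} {q : ℝ × ℝ}

/-- The entry point is strictly below and to the left of `α t`, as the exit rule demands. The lower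
end of the edge is left out: it is handled as a corner. -/
theorem EntryComplete.right (h : EntryComplete F α i j) (hF : IsClosed F)
    (hα : IsStrictMonoCurve F (0, 0) q α) {t : unitInterval} (h₁ : (α t).1 = (i : ℝ) + 1)
    (h₂ : j < (α t).2) (h₃ : (α t).2 ≤ j + 1) : Covers (cellReach F i j).right (α t).2 := by
  have hlt : (i : ℝ) < (α t).1 := h₁ ▸ lt_add_one _
  rw [right_cellReach]
  refine covers_exitReach_endpoints (isCompact_vert hF _ _)
    ⟨⟨h₂.le, h₃⟩, h₁ ▸ hα.mem t⟩ h₂ ?_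
  obtain ⟨s, hst, hs⟩ := hα.exists_entry i.cast_nonneg j.cast_nonneg hlt h₂
  have hs₁ : (α s).1 < (α t).1 := hα.strictMono_fst hst
  have hs₂ : (α s).2 < (α t).2 := hα.strictMono_snd hst
  rcases hs with hs | ⟨hx, hy⟩ | ⟨hy, hx⟩
  · exact Or.inl (h.corner s hs)
  · exact Or.inr (Or.inl ⟨_, hs₂, h.left s hx hy (hs₂.le.trans h₃)⟩)
  · exact Or.inr (Or.inr ⟨_, h₁ ▸ hs₁, h.bottom s hy hx (hs₁.le.trans h₁.le)⟩)

theorem EntryComplete.top (h : EntryComplete F α i j) (hF : IsClosed F)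
    (hα : IsStrictMonoCurve F (0, 0) q α) {t : unitInterval} (h₁ : (α t).2 = (j : ℝ) + 1)
    (h₂ : i < (α t).1) (h₃ : (α t).1 ≤ i + 1) : Covers (cellReach F i j).top (α t).1 := by
  have hlt : (j : ℝ) < (α t).2 := h₁ ▸ lt_add_one _
  rw [top_cellReach]
  refine covers_exitReach_endpoints (isCompact_hor hF _ _)
    ⟨⟨h₂.le, h₃⟩, h₁ ▸ hα.mem t⟩ h₂ ?_
  obtain ⟨s, hst, hs⟩ := hα.exists_entry i.cast_nonneg j.cast_nonneg h₂ hlt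
  have hs₁ : (α s).1 < (α t).1 := hα.strictMono_fst hst
  have hs₂ : (α s).2 < (α t).2 := hα.strictMono_snd hst
  rcases hs with hs | ⟨hx, hy⟩ | ⟨hy, hx⟩
  · exact Or.inl (h.corner s hs)
  · exact Or.inr (Or.inr ⟨_, h₁ ▸ hs₂, h.left s hx hy (hs₂.le.trans h₁.le)⟩)
  · exact Or.inr (Or.inl ⟨_, hs₁, h.bottom s hy hx (hs₁.le.trans h₃)⟩)

theorem IsStrictMonoCurve.eq_zero_of_fst (hα : IsStrictMonoCurve F (0, 0) q α) {t : unitInterval}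
    (h : (α t).1 = 0) : α t = (0, 0) := by
  have : t = 0 := hα.strictMono_fst.injective (by simp [h, hα.source])
  rw [this, hα.source]

theorem IsStrictMonoCurve.eq_zero_of_snd (hα : IsStrictMonoCurve F (0, 0) q α) {t : unitInterval}
    (h : (α t).2 = 0) : α t = (0, 0) := by
  have : t = 0 := hα.strictMono_snd.injective (by simp [h, hα.source])
  rw [this, hα.source]

/-- Strictness makes the curve leave the axes at once; this justifies the empty sublines on the
outer boundary. -/
theorem IsStrictMonoCurve.not_left_boundary (hα : IsStrictMonoCurve F (0, 0) q α)
    {t : unitInterval} (h₁ : (α t).1 = (0 : ℕ)) (h₂ : (j : ℝ) < (α t).2) : False := by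
  rw [hα.eq_zero_of_fst (by simpa using h₁)] at h₂
  exact absurd h₂ (not_lt.2 j.cast_nonneg)

theorem IsStrictMonoCurve.not_bottom_boundary (hα : IsStrictMonoCurve F (0, 0) q α)
    {t : unitInterval} (h₁ : (α t).2 = (0 : ℕ)) (h₂ : (i : ℝ) < (α t).1) : False := by
  rw [hα.eq_zero_of_snd (by simpa using h₁)] at h₂
  exact absurd h₂ (not_lt.2 i.cast_nonneg)

theorem entryComplete (hF : IsCellwiseConvex mf mg F) (hα : IsStrictMonoCurve F (0, 0) q α) :
    ∀ i j : ℕ, i < mf → j < mg → EntryComplete F α i j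
  | 0, 0, _, _ =>
    { corner := fun t ht => by
        rw [corner_cellReach_zero]
        simpa [ht] using hα.mem t
      left := fun t h₁ h₂ _ => (hα.not_left_boundary h₁ h₂).elim
      bottom := fun t h₁ h₂ _ => (hα.not_bottom_boundary h₁ h₂).elim }
  | i + 1, 0, hi, hj =>
    { corner := fun t ht => by
        have := hα.eq_zero_of_snd (t := t) (by simp [ht])
        rw [ht, Prod.mk.injEq] at this
        exact absurd this.1 (Nat.cast_ne_zero.2 i.succ_ne_zero)
      left := fun t h₁ h₂ h₃ => by
        rw [left_cellReach_succ]
        exact (entryComplete hF hα i 0 (Nat.lt_of_succ_lt hi) hj).right hF.isClosed hα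
          (by rw [h₁, Nat.cast_succ]) h₂ h₃
      bottom := fun t h₁ h₂ _ => (hα.not_bottom_boundary h₁ h₂).elim }
  | 0, j + 1, hi, hj =>
    { corner := fun t ht => by
        have := hα.eq_zero_of_fst (t := t) (by simp [ht])
        rw [ht, Prod.mk.injEq] at this
        exact absurd this.2 (Nat.cast_ne_zero.2 j.succ_ne_zero)
      left := fun t h₁ h₂ _ => (hα.not_left_boundary h₁ h₂).elim
      bottom := fun t h₁ h₂ h₃ => by
        rw [bottom_cellReach_succ]
        exact (entryComplete hF hα 0 j hi (Nat.lt_of_succ_lt hj)).top hF.isClosed hα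
          (by rw [h₁, Nat.cast_succ]) h₂ h₃ }
  | i + 1, j + 1, hi, hj =>
    { corner := fun t ht => by
        have hi' := Nat.lt_of_succ_lt hi
        have hj' := Nat.lt_of_succ_lt hj
        have hx : (α t).1 = (i : ℝ) + 1 := by simp [ht]
        have hy : (α t).2 = (j : ℝ) + 1 := by simp [ht]
        -- The vertex is viewed as the upper end of the right edge of cell `(i, j)`; soundness then
        -- makes the covering subline end exactly there.
        have hcov := (entryComplete hF hα i j hi' hj').right hF.isClosed hα hx
          (hy ▸ lt_add_one _) hy.le
        rw [hy] at hcov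
        rw [corner_cellReach_succ]
        exact Or.inr (((entrySound hF i j hi' hj').right hF hi' hj').hiEq_of_covers hcov)
      left := fun t h₁ h₂ h₃ => by
        rw [left_cellReach_succ]
        exact (entryComplete hF hα i (j + 1) (Nat.lt_of_succ_lt hi) hj).right hF.isClosed hα
          (by rw [h₁, Nat.cast_succ]) h₂ h₃
      bottom := fun t h₁ h₂ h₃ => by
        rw [bottom_cellReach_succ]
        exact (entryComplete hF hα (i + 1) j hi (Nat.lt_of_succ_lt hj)).top hF.isClosed hα
          (by rw [h₁, Nat.cast_succ]) h₂ h₃ }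

/-! ### The equivalences in the last cell -/

theorem exists_curve_iff_hiEq (hF : IsCellwiseConvex (i + 1) (j + 1) F) :
    (∃ α : unitInterval → ℝ × ℝ, IsStrictMonoCurve F (0, 0) ((i : ℝ) + 1, (j : ℝ) + 1) α) ↔
      HiEq (cellReach F i j).top ((i : ℝ) + 1) := by
  have hi := i.lt_succ_self
  have hj := j.lt_succ_self
  have htop := (entrySound hF i j hi hj).top hF hi hj
  constructor
  · rintro ⟨α, hα⟩
    have h1 : α 1 = ((i : ℝ) + 1, (j : ℝ) + 1) := hα.target
    have hcov := (entryComplete hF hα i j hi hj).top hF.isClosed hα (t := 1) (by rw [h1])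
      (by simp [h1]) (by rw [h1])
    rw [h1] at hcov
    exact htop.hiEq_of_covers hcov
  · intro h
    exact (htop.of_hi h).exists_curve (by positivity)

theorem mem_topReachablePortion_iff_hiEq (hF : IsCellwiseConvex (i + 1) (j + 1) F) :
    ((i : ℝ) + 1, (j : ℝ) + 1) ∈ topReachablePortion F i j ↔
      HiEq (cellReach F i j).top ((i : ℝ) + 1) := by
  have hi := i.lt_succ_self
  have hj := j.lt_succ_self
  have htop := (entrySound hF i j hi hj).top hF hi hj
  constructor
  · rintro ⟨-, h | ⟨-, h⟩⟩
    · exact htop.hiEq_of_covers h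
    -- The extra corner point of the portion has abscissa `i`, so it never accounts for the point
    -- `(i + 1, j + 1)`.
    · exact absurd h (lt_add_one _).ne'
  · intro h
    obtain ⟨s, hs, hhi⟩ := Option.map_eq_some_iff.1 h
    obtain ⟨⟨c, hc, hlo⟩, -⟩ := htop s hs
    exact ⟨rfl, Or.inl ⟨s, hs, hhi ▸ hc ▸ hlo, hhi.ge⟩⟩

theorem topReachEnd_eq_some_iff {c d : ℝ} :
    topReachEnd F i j = some (exact c, exact d) ↔
      HiEq (cellReach F i j).top c ∧ (j : ℝ) + 1 = d := by
  unfold topReachEnd HiEq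
  cases (cellReach F i j).top <;> simp [exact_inj]

end FrechetDecision

theorem mainTheorem5 {E : Type*} [NormedAddCommGroup E] [NormedSpace ℝ E]
    (mf mg : ℕ) (f g : ℝ → E)
    (hf : FrechetDecision.IsPolygonalCurve mf f) (hg : FrechetDecision.IsPolygonalCurve mg g)
    (δ : ℝ) (hδ : 0 ≤ δ) :
    ((∃ α : unitInterval → ℝ × ℝ,
        FrechetDecision.IsStrictMonoCurve (FrechetDecision.freeSpace mf mg f g δ)
          (0, 0) ((mf : ℝ), (mg : ℝ)) α) ↔
      ((mf : ℝ), (mg : ℝ)) ∈ FrechetDecision.topReachablePortion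
        (FrechetDecision.freeSpace mf mg f g δ) (mf - 1) (mg - 1)) ∧
    (((mf : ℝ), (mg : ℝ)) ∈ FrechetDecision.topReachablePortion
        (FrechetDecision.freeSpace mf mg f g δ) (mf - 1) (mg - 1) ↔
      FrechetDecision.topReachEnd (FrechetDecision.freeSpace mf mg f g δ) (mf - 1) (mg - 1) =
        some (FrechetDecision.exact (mf : ℝ), FrechetDecision.exact (mg : ℝ))) := by
  have hF := FrechetDecision.isCellwiseConvex_freeSpace hf hg δ
  obtain ⟨i, rfl⟩ := Nat.exists_eq_succ_of_ne_zero hf.pos.ne'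
  obtain ⟨j, rfl⟩ := Nat.exists_eq_succ_of_ne_zero hg.pos.ne'
  rw [FrechetDecision.topReachEnd_eq_some_iff]
  simp only [Nat.succ_eq_add_one, Nat.add_sub_cancel, Nat.cast_add, Nat.cast_one, and_true] at hF ⊢
  rw [FrechetDecision.exists_curve_iff_hiEq hF, FrechetDecision.mem_topReachablePortion_iff_hiEq hF]
  exact ⟨Iff.rfl, Iff.rfl⟩
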